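/- Fix function symbols over $\mathbb R$ that include binary multiplication $\cdot$ and a unary symbol $\sigma$ denoting the sigmoid $\sigma(x)=1/(1+e^{-x})$. All these source symbols denote differentiable maps, and each partial derivative of a source symbol $f$ is denoted by some function symbol $\partial_i f$. Write $\underline r$ for the numeral of $r\in\mathbb R$. In the simply typed $\lambda$-calculus with ground type $\mathsf R$, products, explicit substitutions, numerals, $+$ and these symbols, consider $$L:=\lambda x.\lambda h.\,\sigma(\epsilon\cdot x+\rho\cdot h),\qquad N:=\lambda l.\,l\,L\,\underline 0,$$ with free variables $\epsilon,\rho:\mathsf R$. For $n\ge 0$ and reals $a_1,\dots,a_n$, consider the Church list $$l:=[\underline{a_1};\dots;\underline{a_n}]=\lambda f.\lambda x.\,f\,\underline{a_1}\,(f\,\underline{a_2}\cdots(f\,\underline{a_n}\,x)\cdots).$$ Let $\llbracket Nl\rrbracket:\mathbb R^2\to\mathbb R$ be the function of $(\epsilon,\rho)$ denoted by $Nl$ in the set-theoretic model. Write $\nabla t(e,r)$ for the pair of numerals of the two partial derivatives of $\llbracket t\rrbracket$ at $(e,r)$. For $e,r\in\mathbb R$ and $0\le i<n$ define $$u_0=0,\quad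 u_{i+1}=\sigma(e\,a_{n-i}+r\,u_i),\qquad \sigma'_{i+1}=\sigma'(e\,a_{n-i}+r\,u_i),$$ $$g^0_\epsilon=0,\quad g^{i+1}_\epsilon=\sigma'_{i+1}\,(a_{n-i}+r\,g^i_\epsilon),\qquad g^0_\rho=0,\quad g^{i+1}_\rho=\sigma'_{i+1}\,(u_i+r\,g^i_\rho).$$ **Proposition.** 1. The function $\llbracket Nl\rrbracket$ is differentiable, and $\nabla(Nl)(e,r)=\langle \underline{g^n_\epsilon},\underline{g^n_\rho}\rangle$. 2. This gradient is computed by the reverse gradient transformation. Let $E=\mathbb R^{k}$ with $k\ge1$, and let $\mathsf R^\perp$ be the type of linear maps $\mathbb R\multimap E$. Let $\overleftarrow{\mathbf D}$ be the transformation of types and terms that sends $\mathsf R$ to $\mathsf R\times\mathsf R^\perp$ and commutes with variables, $\lambda$, application, pairs, pair destructuring and explicit substitution. On numerals, sums and function symbols it is given by $$\overleftarrow{\mathbf D}(\underline q)=\langle\underline q,\lambda a.\underline{\mathbf 0}\rangle,\qquad \overleftarrow{\mathbf D}(t+u)=\langle x+y,\lambda a.(x^*a+y^*a)\rangle[\langle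 x,x^*\rangle/\overleftarrow{\mathbf D}(t)][\langle y,y^*\rangle/\overleftarrow{\mathbf D}(u)],$$ $$\overleftarrow{\mathbf D}(f(t_1,\dots,t_m))=\langle f(\mathbf x),\lambda a.\textstyle\sum_{i} x_i^*(\partial_i f(\mathbf x)\cdot a)\rangle[\langle x_1,x_1^*\rangle/\overleftarrow{\mathbf D}(t_1)]\cdots[\langle x_m,x_m^*\rangle/\overleftarrow{\mathbf D}(t_m)].$$ Then, for free variables $\epsilon^*,\rho^*:\mathsf R^\perp$, there is a set $J\subseteq\{\epsilon,\rho\}$, independent of $k$, with $g^n_j=0$ for $j\notin J$, such that $$(z^*\underline 1)\big[\langle z,z^*\rangle/\overleftarrow{\mathbf D}(Nl)[\epsilon/\langle\epsilon,\lambda a.\epsilon^*a\rangle][\rho/\langle\rho,\lambda a.\rho^*a\rangle]\big][\epsilon/\underline e][\rho/\underline r]\;\to^*\;\sum_{j\in J}j^*\,\underline{g^n_j}.$$ Here $\to$ is reduction, in arbitrary contexts, in the linear substitution calculus with the following rules, where $\alpha,\beta$ stand for lists of explicit substitutions. The evaluation rules are - $(\lambda x.t)\alpha\,u\to t[x/u]\alpha$;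 - $s[\langle x,y\rangle/\langle t,u\rangle\alpha]\to s[x/t][y/u]\alpha$; - replacement, for a value $v$, of one occurrence of $x$ in the scope of $[x/v\alpha]$ by $v$; - removal of $[x/v\alpha]$, leaving $\alpha$, when $v$ is a value and $x$ does not occur; - $t[x/v\alpha]\to t\{v/x\}\alpha$ for a linear variable $x$ and a value $v$; - componentwise addition of pairs, and evaluation of $+$ and of function symbols on numerals. The remaining rules are $\eta$-expansion at arrow, $\mathsf R^\perp$ and product types, and linear factoring $(x\alpha\,t)\beta+(x\alpha' t')\beta'\to x(t+t')\alpha\beta\alpha'\beta'$ for $x:\mathsf R^\perp$. Finite sums are read up to associativity and commutativity of $+$ and up to dropping null summands. -/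

import Mathlib

/-! ### Signatures -/

/-- Function symbols over the reals, indexed by their arity: a set `F` of source symbols, contained
(via `incl`) in a larger set `F'`, such that every symbol of `F` denotes a differentiable map and
has its partial derivatives among the symbols of `F'`.  Multiplication and the sigmoid function
are among the source symbols. -/
structure Signature where
  F : ℕ → Type
  F' : ℕ → Type
  incl : {k : ℕ} → F k → F' k
  sem : {k : ℕ} → F' k → (Fin k → ℝ) → ℝ
  differentiable : ∀ {k : ℕ} (f : F k), Differentiable ℝ (sem (incl f))
  par : {k : ℕ} → F k → Fin k → F' k
  sem_par : ∀ {k : ℕ} (f : F k) (i : Fin k) (v : Fin k → ℝ),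
    sem (par f i) v = deriv (fun s => sem (incl f) (Function.update v i s)) (v i)
  mul : F 2
  sem_mul : ∀ v : Fin 2 → ℝ, sem (incl mul) v = v 0 * v 1
  sig : F 1
  sem_sig : ∀ v : Fin 1 → ℝ, sem (incl sig) v = Real.sigmoid (v 0)

/-! ### The source calculus: simply typed terms with products and explicit substitutions

Terms are intrinsically typed, with de Bruijn variables. -/

/-- Simple types without linear negation. -/
inductive STy : Type
  | R : STy
  | prod : STy → STy → STy
  | arr : STy → STy → STy

/-- `Var Γ A`: a variable of type `A` in the typing context `Γ`. -/
inductive Var : List STy → STy → Type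
  | zero {Γ : List STy} {A : STy} : Var (A :: Γ) A
  | succ {Γ : List STy} {A B : STy} : Var Γ A → Var (B :: Γ) A

/-- The de Bruijn index of a variable. -/
def Var.idx : {Γ : List STy} → {A : STy} → Var Γ A → ℕ
  | _, _, .zero => 0
  | _, _, .succ x => x.idx + 1

/-- `STm S Γ A`: the source terms `t` with `Γ ⊢ t : A`.
`letp t u` is `t[⟨x, y⟩/u]`, where `x` has index `0` and `y` has index `1` in `t`;
`esub t u` is the explicit substitution `t[x/u]`, where `x` has index `0` in `t`. -/
inductive STm (S : Signature) : List STy → STy → Type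
  | var {Γ : List STy} {A : STy} : Var Γ A → STm S Γ A
  | num {Γ : List STy} : ℝ → STm S Γ .R
  | lam {Γ : List STy} {A B : STy} : STm S (A :: Γ) B → STm S Γ (.arr A B)
  | app {Γ : List STy} {A B : STy} : STm S Γ (.arr A B) → STm S Γ A → STm S Γ B
  | pair {Γ : List STy} {A B : STy} : STm S Γ A → STm S Γ B → STm S Γ (.prod A B)
  | letp {Γ : List STy} {A B C : STy} :
      STm S (A :: B :: Γ) C → STm S Γ (.prod A B) → STm S Γ C
  | esub {Γ : List STy} {A C : STy} : STm S (A :: Γ) C → STm S Γ A → STm S Γ C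
  | add {Γ : List STy} : STm S Γ .R → STm S Γ .R → STm S Γ .R
  | fn {Γ : List STy} {k : ℕ} : S.F k → (Fin k → STm S Γ .R) → STm S Γ .R

/-- Interpretation of types as sets. -/
def STy.sem : STy → Type
  | .R => ℝ
  | .prod A B => A.sem × B.sem
  | .arr A B => A.sem → B.sem

/-- Interpretation of typing contexts as products. -/
def Env : List STy → Type
  | [] => Unit
  | A :: Γ => A.sem × Env Γ

def Var.sem : {Γ : List STy} → {A : STy} → Var Γ A → Env Γ → A.sem
  | _, _, .zero, g => g.1
  | _, _, .succ x, g => x.sem g.2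

/-- The denotation of a term in the model of sets and functions. -/
def STm.sem {S : Signature} : {Γ : List STy} → {A : STy} → STm S Γ A → Env Γ → A.sem
  | _, _, .var x, g => x.sem g
  | _, _, .num r, _ => r
  | _, _, .lam t, g => fun a => t.sem (a, g)
  | _, _, .app t u, g => t.sem g (u.sem g)
  | _, _, .pair t u, g => (t.sem g, u.sem g)
  | _, _, .letp t u, g => t.sem ((u.sem g).1, (u.sem g).2, g)
  | _, _, .esub t u, g => t.sem (u.sem g, g)
  | _, _, .add t u, g =>
      let x : ℝ := t.sem g
      let y : ℝ := u.sem g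
      x + y
  | _, _, .fn f ts, g => S.sem (S.incl f) (fun i => (ts i).sem g)

/-- The context `x₁ : R, …, xₙ : R`. -/
abbrev realCtx (n : ℕ) : List STy := List.replicate n .R

/-- The element `(v₁, …, vₙ)` of the interpretation of `x₁ : R, …, xₙ : R`. -/
def realEnv : (n : ℕ) → (Fin n → ℝ) → Env (realCtx n)
  | 0, _ => ()
  | n + 1, v => (v 0, realEnv n (fun i => v i.succ))

/-- The `n`-ary real function denoted by a term `x₁ : R, …, xₙ : R ⊢ t : R`. -/
def STm.realFun {S : Signature} {n : ℕ} (t : STm S (realCtx n) .R) (v : Fin n → ℝ) : ℝ :=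
  t.sem (realEnv n v)

/-! ### The target calculus: adding linear negation and linear variables

Raw terms, with de Bruijn variables and annotated binders. -/

/-- Types. The Euclidean type `euc d` below is `R^(d+1)`, and `neg d` is the linear negation
`R ⊸ R^(d+1)`. -/
inductive Ty : Type
  | R : Ty
  | prod : Ty → Ty → Ty
  | arr : Ty → Ty → Ty
  | neg : ℕ → Ty

/-- `euc d` is the Euclidean type `R^(d+1) = R × (⋯ × R)`. -/
def euc : ℕ → Ty
  | 0 => .R
  | d + 1 => .prod .R (euc d)

/-- Annotations of variables: exponential of type `A`, or linear (of type `R`). -/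
inductive Ann : Type
  | exp : Ty → Ann
  | lin : Ann

/-- `lam a t` is `λ x^a. t`; `letp A B t u` is `t[⟨x^A, y^B⟩/u]`, where `x` has index `0` and `y` has
index `1` in `t`; `esub a t u` is `t[x^a/u]`. -/
inductive Tm (S : Signature) : Type
  | var : ℕ → Tm S
  | num : ℝ → Tm S
  | lam : Ann → Tm S → Tm S
  | app : Tm S → Tm S → Tm S
  | pair : Tm S → Tm S → Tm S
  | letp : Ty → Ty → Tm S → Tm S → Tm S
  | esub : Ann → Tm S → Tm S → Tm S
  | add : Tm S → Tm S → Tm S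
  | fn : {k : ℕ} → S.F' k → (Fin k → Tm S) → Tm S

/-- Going under one binder with a renaming. -/
def liftR (ξ : ℕ → ℕ) : ℕ → ℕ
  | 0 => 0
  | i + 1 => ξ i + 1

/-- Going under `m` binders with a renaming. -/
def liftRN : ℕ → (ℕ → ℕ) → ℕ → ℕ
  | 0, ξ => ξ
  | m + 1, ξ => liftR (liftRN m ξ)

namespace Tm

variable {S : Signature}

/-- Renaming of free variables. -/
def ren : (ℕ → ℕ) → Tm S → Tm S
  | ξ, var i => var (ξ i)
  | _, num r => num r
  | ξ, lam a t => lam a (ren (liftR ξ) t)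
  | ξ, app t u => app (ren ξ t) (ren ξ u)
  | ξ, pair t u => pair (ren ξ t) (ren ξ u)
  | ξ, letp A B t u => letp A B (ren (liftR (liftR ξ)) t) (ren ξ u)
  | ξ, esub a t u => esub a (ren (liftR ξ) t) (ren ξ u)
  | ξ, add t u => add (ren ξ t) (ren ξ u)
  | ξ, fn f ts => fn f (fun i => ren ξ (ts i))

/-- Weakening by `m` variables. -/
def shift (m : ℕ) (t : Tm S) : Tm S := ren (fun i => i + m) t

/-- Going under one binder with a substitution. -/
def liftS (s : ℕ → Tm S) : ℕ → Tm S
  | 0 => var 0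
  | i + 1 => shift 1 (s i)

/-- Capture-avoiding simultaneous substitution. -/
def sub : (ℕ → Tm S) → Tm S → Tm S
  | s, var i => s i
  | _, num r => num r
  | s, lam a t => lam a (sub (liftS s) t)
  | s, app t u => app (sub s t) (sub s u)
  | s, pair t u => pair (sub s t) (sub s u)
  | s, letp A B t u => letp A B (sub (liftS (liftS s)) t) (sub s u)
  | s, esub a t u => esub a (sub (liftS s) t) (sub s u)
  | s, add t u => add (sub s t) (sub s u)
  | s, fn f ts => fn f (fun i => sub s (ts i))

/-- `inst v t` is `t{v/x}`, where `x` is the variable of index `0`. -/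
def inst (v t : Tm S) : Tm S :=
  sub (fun i => match i with
    | 0 => v
    | i + 1 => var i) t

/-- `t · u`. -/
def mul (t u : Tm S) : Tm S := fn (S.incl S.mul) ![t, u]

/-- The tuple `⟨t₀, …, tₙ⟩`, nested to the right. -/
def tuple : (n : ℕ) → (Fin (n + 1) → Tm S) → Tm S
  | 0, ts => ts 0
  | n + 1, ts => pair (ts 0) (tuple n (fun i => ts i.succ))

/-- The null vector of `R^(d+1)`. -/
def zeroVec (d : ℕ) : Tm S := tuple d (fun _ => num 0)

/-- A finite sum of terms of type `R^(d+1)`; the empty sum is the null vector. -/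
def sum (d : ℕ) : List (Tm S) → Tm S
  | [] => zeroVec d
  | [t] => t
  | t :: u :: ts => add t (sum d (u :: ts))

/-- Values. -/
inductive IsValue : Tm S → Prop
  | var (i : ℕ) : IsValue (var i)
  | num (r : ℝ) : IsValue (num r)
  | lam (a : Ann) (t : Tm S) : IsValue (lam a t)
  | pair {v w : Tm S} : IsValue v → IsValue w → IsValue (pair v w)

/-- `Repl i v t t'`: the term `t'` is obtained from `t` by replacing exactly one free occurrence of
the variable `i` by `v`. -/
inductive Repl : ℕ → Tm S → Tm S → Tm S → Prop
  | here {i : ℕ} {v : Tm S} : Repl i v (var i) v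
  | lam {i : ℕ} {v : Tm S} {a : Ann} {t t' : Tm S} :
      Repl (i + 1) (shift 1 v) t t' → Repl i v (lam a t) (lam a t')
  | app_left {i : ℕ} {v t t' u : Tm S} : Repl i v t t' → Repl i v (app t u) (app t' u)
  | app_right {i : ℕ} {v t u u' : Tm S} : Repl i v u u' → Repl i v (app t u) (app t u')
  | pair_left {i : ℕ} {v t t' u : Tm S} : Repl i v t t' → Repl i v (pair t u) (pair t' u)
  | pair_right {i : ℕ} {v t u u' : Tm S} : Repl i v u u' → Repl i v (pair t u) (pair t u')
  | letp_body {i : ℕ} {v : Tm S} {A B : Ty} {t t' u : Tm S} :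
      Repl (i + 2) (shift 2 v) t t' → Repl i v (letp A B t u) (letp A B t' u)
  | letp_arg {i : ℕ} {v : Tm S} {A B : Ty} {t u u' : Tm S} :
      Repl i v u u' → Repl i v (letp A B t u) (letp A B t u')
  | esub_body {i : ℕ} {v : Tm S} {a : Ann} {t t' u : Tm S} :
      Repl (i + 1) (shift 1 v) t t' → Repl i v (esub a t u) (esub a t' u)
  | esub_arg {i : ℕ} {v : Tm S} {a : Ann} {t u u' : Tm S} :
      Repl i v u u' → Repl i v (esub a t u) (esub a t u')
  | add_left {i : ℕ} {v t t' u : Tm S} : Repl i v t t' → Repl i v (add t u) (add t' u)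
  | add_right {i : ℕ} {v t u u' : Tm S} : Repl i v u u' → Repl i v (add t u) (add t u')
  | fn {i : ℕ} {v : Tm S} {k : ℕ} {f : S.F' k} {ts : Fin k → Tm S} {j : Fin k} {t' : Tm S} :
      Repl i v (ts j) t' → Repl i v (fn f ts) (fn f (Function.update ts j t'))

/-- `HasTy Γ z t A` is the typing judgement `Γ ⊢ t : A` if `z = none`, and the judgement
`Γ ⊢_z t : A` with linear variable `i` if `z = some i`. -/
inductive HasTy : List Ann → Option ℕ → Tm S → Ty → Prop
  | var {Γ : List Ann} {i : ℕ} {A : Ty} :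
      Γ[i]? = some (.exp A) → HasTy Γ none (var i) A
  | lvar {Γ : List Ann} {i : ℕ} :
      Γ[i]? = some .lin → HasTy Γ (some i) (var i) .R
  | num {Γ : List Ann} {r : ℝ} : HasTy Γ none (num r) .R
  | zero {Γ : List Ann} {i d : ℕ} : HasTy Γ (some i) (zeroVec d) (euc d)
  | pair {Γ : List Ann} {t u : Tm S} {A B : Ty} :
      HasTy Γ none t A → HasTy Γ none u B → HasTy Γ none (pair t u) (.prod A B)
  | lpair {Γ : List Ann} {i d : ℕ} {t u : Tm S} :
      HasTy Γ (some i) t .R → HasTy Γ (some i) u (euc d) →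
      HasTy Γ (some i) (pair t u) (euc (d + 1))
  | letp {Γ : List Ann} {z : Option ℕ} {t u : Tm S} {A B C : Ty} :
      HasTy Γ none u (.prod A B) →
      HasTy (.exp A :: .exp B :: Γ) (z.map fun i => i + 2) t C → HasTy Γ z (letp A B t u) C
  | lam {Γ : List Ann} {t : Tm S} {A B : Ty} :
      HasTy (.exp A :: Γ) none t B → HasTy Γ none (lam (.exp A) t) (.arr A B)
  | app {Γ : List Ann} {t u : Tm S} {A B : Ty} :
      HasTy Γ none t (.arr A B) → HasTy Γ none u A → HasTy Γ none (app t u) B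
  | llam {Γ : List Ann} {t : Tm S} {d : ℕ} :
      HasTy (.lin :: Γ) (some 0) t (euc d) → HasTy Γ none (lam .lin t) (.neg d)
  | lapp {Γ : List Ann} {z : Option ℕ} {t u : Tm S} {d : ℕ} :
      HasTy Γ none t (.neg d) → HasTy Γ z u .R → HasTy Γ z (app t u) (euc d)
  | esub {Γ : List Ann} {z : Option ℕ} {t u : Tm S} {A C : Ty} :
      HasTy Γ none u A → HasTy (.exp A :: Γ) (z.map fun i => i + 1) t C →
      HasTy Γ z (esub (.exp A) t u) C
  | lesub {Γ : List Ann} {z : Option ℕ} {t u : Tm S} {d : ℕ} :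
      HasTy Γ z u .R → HasTy (.lin :: Γ) (some 0) t (euc d) →
      HasTy Γ z (esub .lin t u) (euc d)
  | fn {Γ : List Ann} {k : ℕ} {f : S.F' k} {ts : Fin k → Tm S} :
      (∀ j, HasTy Γ none (ts j) .R) → HasTy Γ none (fn f ts) .R
  | lmul_left {Γ : List Ann} {i : ℕ} {t u : Tm S} :
      HasTy Γ (some i) t .R → HasTy Γ none u .R → HasTy Γ (some i) (mul t u) .R
  | lmul_right {Γ : List Ann} {i : ℕ} {t u : Tm S} :
      HasTy Γ none t .R → HasTy Γ (some i) u .R → HasTy Γ (some i) (mul t u) .R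
  | add {Γ : List Ann} {z : Option ℕ} {t u : Tm S} {d : ℕ} :
      HasTy Γ z t (euc d) → HasTy Γ z u (euc d) → HasTy Γ z (add t u) (euc d)

end Tm

/-! ### Substitution contexts -/

/-- One explicit substitution `[x^a/u]` or `[⟨x^A, y^B⟩/u]`. -/
inductive Entry (S : Signature) : Type
  | one : Ann → Tm S → Entry S
  | two : Ty → Ty → Tm S → Entry S

namespace Entry

variable {S : Signature}

/-- The number of variables bound by an entry. -/
def size : Entry S → ℕ
  | one _ _ => 1
  | two _ _ _ => 2

def ren (ξ : ℕ → ℕ) : Entry S → Entry S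
  | one a u => one a (u.ren ξ)
  | two A B u => two A B (u.ren ξ)

def bind (t : Tm S) : Entry S → Tm S
  | one a u => .esub a t u
  | two A B u => .letp A B t u

end Entry

/-- A substitution context `{·}[p₁/t₁]⋯[pₙ/tₙ]`, as a list with the innermost entry first. -/
abbrev SCtx (S : Signature) : Type := List (Entry S)

namespace SCtx

variable {S : Signature}

/-- The number of variables bound by a substitution context. -/
def size : SCtx S → ℕ
  | [] => 0
  | e :: α => e.size + size α

/-- `plug α t` is `tα`. -/
def plug : SCtx S → Tm S → Tm S
  | [], t => t
  | e :: α, t => plug α (e.bind t)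

/-- Renaming of the free variables of a substitution context. -/
def ren (ξ : ℕ → ℕ) : SCtx S → SCtx S
  | [] => []
  | e :: α => e.ren (liftRN (size α) ξ) :: ren ξ α

/-- The substitution context `αβ` (first `α`, then `β` around it), where the bound variables of `β`
are fresh for `α`. -/
def comp (α β : SCtx S) : SCtx S := ren (fun i => i + size β) α ++ β

/-- The substitution context `α₁⋯αₖ`. -/
def compAll : (k : ℕ) → (Fin k → SCtx S) → SCtx S
  | 0, _ => []
  | k + 1, α => comp (compAll k (fun i => α i.castSucc)) (α (Fin.last k))

end SCtx

/-! ### Reduction -/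

open SCtx in
/-- The root reduction steps `t → u`, for terms whose free variables are annotated by `Γ`. -/
inductive Root {S : Signature} : List Ann → Tm S → Tm S → Prop
  /-- `(λx.t)α u → t[x/u]α` -/
  | beta {Γ : List Ann} (a : Ann) (t u : Tm S) (α : SCtx S) :
      Root Γ (.app (plug α (.lam a t)) u) (plug α (.esub a t (u.shift (size α))))
  /-- `s[⟨x, y⟩/⟨t, u⟩α] → s[x/t][y/u]α` -/
  | unpair {Γ : List Ann} (A B : Ty) (s t u : Tm S) (α : SCtx S) :
      Root Γ (.letp A B s (plug α (.pair t u)))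
        (plug α (.esub (.exp B)
          (.esub (.exp A) (s.ren (liftRN 2 fun i => i + size α)) (t.shift 1)) u))
  /-- `C{x}[x/vα] → C{v}[x/v]α`, for `x` exponential and `v` a value -/
  | subst {Γ : List Ann} (A : Ty) (t t' v : Tm S) (α : SCtx S) :
      v.IsValue → Tm.Repl 0 (v.shift 1) (t.ren (liftR fun i => i + size α)) t' →
      Root Γ (.esub (.exp A) t (plug α v)) (plug α (.esub (.exp A) t' v))
  /-- `t[x/vα] → tα`, for `x` exponential and not free in `t`, and `v` a value -/
  | gc {Γ : List Ann} (A : Ty) (t v : Tm S) (α : SCtx S) :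
      v.IsValue →
      Root Γ (.esub (.exp A) (t.shift 1) (plug α v)) (plug α (t.shift (size α)))
  /-- `t[x/vα] → t{v/x}α`, for `x` linear and `v` a value -/
  | lin {Γ : List Ann} (t v : Tm S) (α : SCtx S) :
      v.IsValue →
      Root Γ (.esub .lin t (plug α v)) (plug α (Tm.inst v (t.ren (liftR fun i => i + size α))))
  /-- `rα + qβ → (r + q)αβ`, for numerals `r` and `q` -/
  | plus {Γ : List Ann} (r q : ℝ) (α β : SCtx S) :
      Root Γ (.add (plug α (.num r)) (plug β (.num q))) (plug (comp α β) (.num (r + q)))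
  /-- `⟨t₁, t₂⟩α + ⟨u₁, u₂⟩β → ⟨t₁ + u₁, t₂ + u₂⟩αβ` -/
  | plusPair {Γ : List Ann} (t₁ t₂ u₁ u₂ : Tm S) (α β : SCtx S) :
      Root Γ (.add (plug α (.pair t₁ t₂)) (plug β (.pair u₁ u₂)))
        (plug (comp α β) (.pair
          (.add (t₁.ren (liftRN (size α) fun i => i + size β)) (u₁.shift (size α)))
          (.add (t₂.ren (liftRN (size α) fun i => i + size β)) (u₂.shift (size α)))))
  /-- `f(r₁α₁, …, rₖαₖ) → f(r₁, …, rₖ)α₁⋯αₖ`, for numerals `rᵢ` and any function symbol `f`,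
  multiplication included -/
  | fn {Γ : List Ann} {k : ℕ} (f : S.F' k) (r : Fin k → ℝ) (α : Fin k → SCtx S) :
      Root Γ (.fn f fun i => plug (α i) (.num (r i)))
        (plug (compAll k α) (.num (S.sem f r)))
  /-- `t → λy.ty`, for `t` of arrow type -/
  | eta {Γ : List Ann} (t : Tm S) (A B : Ty) :
      Tm.HasTy Γ none t (.arr A B) → Root Γ t (.lam (.exp A) (.app (t.shift 1) (.var 0)))
  /-- `t → λy.ty`, for `t` of linear negation type -/
  | etaLin {Γ : List Ann} (t : Tm S) (d : ℕ) :
      Tm.HasTy Γ none t (.neg d) → Root Γ t (.lam .lin (.app (t.shift 1) (.var 0)))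
  /-- `t[x/⟨u, u'⟩] → t[x/⟨y, y'⟩][⟨y, y'⟩/⟨u, u'⟩]` -/
  | etaPair {Γ : List Ann} (A B : Ty) (t u u' : Tm S) :
      Root Γ (.esub (.exp (.prod A B)) t (.pair u u'))
        (.letp A B (.esub (.exp (.prod A B)) (t.ren (liftR fun i => i + 2))
          (.pair (.var 0) (.var 1))) (.pair u u'))
  /-- linear factoring `(xα t)β + (xα' t')β' → x(t + t')αβα'β'`, for `x` of linear negation type -/
  | factor {Γ : List Ann} (x d : ℕ) (t t' : Tm S) (α β α' β' : SCtx S) :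
      Γ[x]? = some (.exp (.neg d)) →
      Root Γ
        (.add (plug β (.app (plug α (.var (x + size β + size α))) t))
          (plug β' (.app (plug α' (.var (x + size β' + size α'))) t')))
        (plug (comp (α ++ β) (α' ++ β'))
          (.app (.var (x + size (α ++ β) + size (α' ++ β')))
            (.add ((t.ren (liftRN (size β) fun i => i + size (α' ++ β'))).shift (size α))
              (t'.shift (size (α ++ β) + size α')))))

/-- The equations that are implicit in writing finite sums `∑ tᵢ` without parentheses:
associativity and commutativity of `+`, and dropping a null summand. -/
inductive SumEq {S : Signature} : List Ann → Tm S → Tm S → Prop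
  | comm {Γ : List Ann} (t u : Tm S) : SumEq Γ (.add t u) (.add u t)
  | assoc {Γ : List Ann} (s t u : Tm S) :
      SumEq Γ (.add (.add s t) u) (.add s (.add t u))
  | zero {Γ : List Ann} (t : Tm S) (d : ℕ) : SumEq Γ (.add t (.zeroVec d)) t

/-- The closure of a relation under arbitrary one-hole contexts. -/
inductive CtxClosure {S : Signature} (P : List Ann → Tm S → Tm S → Prop) :
    List Ann → Tm S → Tm S → Prop
  | root {Γ : List Ann} {t u : Tm S} : P Γ t u → CtxClosure P Γ t u
  | lam {Γ : List Ann} {a : Ann} {t t' : Tm S} :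
      CtxClosure P (a :: Γ) t t' → CtxClosure P Γ (.lam a t) (.lam a t')
  | app_left {Γ : List Ann} {t t' u : Tm S} :
      CtxClosure P Γ t t' → CtxClosure P Γ (.app t u) (.app t' u)
  | app_right {Γ : List Ann} {t u u' : Tm S} :
      CtxClosure P Γ u u' → CtxClosure P Γ (.app t u) (.app t u')
  | pair_left {Γ : List Ann} {t t' u : Tm S} :
      CtxClosure P Γ t t' → CtxClosure P Γ (.pair t u) (.pair t' u)
  | pair_right {Γ : List Ann} {t u u' : Tm S} :
      CtxClosure P Γ u u' → CtxClosure P Γ (.pair t u) (.pair t u')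
  | letp_body {Γ : List Ann} {A B : Ty} {t t' u : Tm S} :
      CtxClosure P (.exp A :: .exp B :: Γ) t t' →
      CtxClosure P Γ (.letp A B t u) (.letp A B t' u)
  | letp_arg {Γ : List Ann} {A B : Ty} {t u u' : Tm S} :
      CtxClosure P Γ u u' → CtxClosure P Γ (.letp A B t u) (.letp A B t u')
  | esub_body {Γ : List Ann} {a : Ann} {t t' u : Tm S} :
      CtxClosure P (a :: Γ) t t' → CtxClosure P Γ (.esub a t u) (.esub a t' u)
  | esub_arg {Γ : List Ann} {a : Ann} {t u u' : Tm S} :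
      CtxClosure P Γ u u' → CtxClosure P Γ (.esub a t u) (.esub a t u')
  | add_left {Γ : List Ann} {t t' u : Tm S} :
      CtxClosure P Γ t t' → CtxClosure P Γ (.add t u) (.add t' u)
  | add_right {Γ : List Ann} {t u u' : Tm S} :
      CtxClosure P Γ u u' → CtxClosure P Γ (.add t u) (.add t u')
  | fn {Γ : List Ann} {k : ℕ} {f : S.F' k} {ts : Fin k → Tm S} {j : Fin k} {t' : Tm S} :
      CtxClosure P Γ (ts j) t' → CtxClosure P Γ (.fn f ts) (.fn f (Function.update ts j t'))

/-- `Reduces Γ t u`: `t →* u`, where finite sums are read up to associativity, commutativity and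
null summands. -/
def Reduces {S : Signature} (Γ : List Ann) : Tm S → Tm S → Prop :=
  Relation.ReflTransGen fun t u => CtxClosure Root Γ t u ∨ CtxClosure SumEq Γ t u

/-! ### The reverse gradient transformation relative to `R^(d+1)` -/

/-- The action on types. -/
def STy.rev (d : ℕ) : STy → Ty
  | .R => .prod .R (.neg d)
  | .prod A B => .prod (A.rev d) (B.rev d)
  | .arr A B => .arr (A.rev d) (B.rev d)

/-- `b[⟨x₁, x₁*⟩/t₁]⋯[⟨xₖ, xₖ*⟩/tₖ]`; in `b`, the variable `xᵢ₊₁` has index `2i` and `xᵢ₊₁*` has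
index `2i + 1`. -/
def letPairs {S : Signature} (d : ℕ) : (k : ℕ) → (Fin k → Tm S) → Tm S → Tm S
  | 0, _, b => b
  | k + 1, ts, b =>
      .letp .R (.neg d) (letPairs d k (fun i => (ts i.castSucc).shift 2) b) (ts (Fin.last k))

/-- The action on terms. For a sum `t + u` it is
`⟨x + y, λa. x* a + y* a⟩[⟨x, x*⟩/t'][⟨y, y*⟩/u']`, and for `f(t₁, …, tₖ)` it is
`⟨f(x₁, …, xₖ), λa. ∑ᵢ xᵢ* (∂ᵢf(x₁, …, xₖ) · a)⟩[⟨x₁, x₁*⟩/t₁']⋯[⟨xₖ, xₖ*⟩/tₖ']`,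
where a prime denotes the transformed term. -/
def STm.rev {S : Signature} (d : ℕ) : {Γ : List STy} → {A : STy} → STm S Γ A → Tm S
  | _, _, .var x => .var x.idx
  | _, _, .num r => .pair (.num r) (.lam .lin (.zeroVec d))
  | _, _, .lam (A := A) t => .lam (.exp (A.rev d)) (t.rev d)
  | _, _, .app t u => .app (t.rev d) (u.rev d)
  | _, _, .pair t u => .pair (t.rev d) (u.rev d)
  | _, _, .letp (A := A) (B := B) t u => .letp (A.rev d) (B.rev d) (t.rev d) (u.rev d)
  | _, _, .esub (A := A) t u => .esub (.exp (A.rev d)) (t.rev d) (u.rev d)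
  | _, _, .add t u =>
      .letp .R (.neg d)
        (.letp .R (.neg d)
          (.pair (.add (.var 0) (.var 2))
            (.lam .lin (.add (.app (.var 2) (.var 0)) (.app (.var 4) (.var 0)))))
          ((t.rev d).shift 2))
        (u.rev d)
  | _, _, .fn (k := k) f ts =>
      letPairs d k (fun i => (ts i).rev d)
        (.pair (.fn (S.incl f) fun j : Fin k => .var (2 * (j : ℕ)))
          (.lam .lin (Tm.sum d ((List.finRange k).map fun i : Fin k =>
            .app (.var (2 * (i : ℕ) + 2))
              (.mul (.fn (S.par f i) fun j : Fin k => .var (2 * (j : ℕ) + 1)) (.var 0))))))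

/-- `t[x₁/u₁]⋯[xₙ/uₙ]` for variables `xᵢ` annotated by `a`; in `t`, `xᵢ₊₁` has index `i`. -/
def esubs {S : Signature} (a : Ann) : (n : ℕ) → (Fin n → Tm S) → Tm S → Tm S
  | 0, _, t => t
  | n + 1, us, t => .esub a (esubs a n (fun i => (us i.castSucc).shift 1) t) (us (Fin.last n))

/-- The program `(z* 1)[⟨z, z*⟩/t'[x₁/⟨x₁, λa. x₁* a⟩]⋯[xₙ/⟨xₙ, λa. xₙ* a⟩]][x₁/r₁]⋯[xₙ/rₙ]`, where `t'`
is the transform of `t`. Its free variables are `x₁*, …, xₙ*`, of type `neg d`, with `xᵢ₊₁*` of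
index `i`. -/
def STm.gradProgram {S : Signature} (d : ℕ) {n : ℕ} (t : STm S (realCtx n) .R)
    (r : Fin n → ℝ) : Tm S :=
  esubs (.exp .R) n (fun i => .num (r i))
    (.letp .R (.neg d) (.app (.var 1) (.num 1))
      (esubs (.exp (STy.R.rev d)) n
        (fun i : Fin n => .pair (.var (i : ℕ)) (.lam .lin (.app (.var (n + (i : ℕ) + 1)) (.var 0))))
        (t.rev d)))

/-- The sum `∑_{j ∈ J} xⱼ* gⱼ`, where `xⱼ₊₁*` has index `j`. -/
def taggedSum {S : Signature} (d : ℕ) {n : ℕ} (J : Finset (Fin n)) (g : Fin n → ℝ) : Tm S :=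
  Tm.sum d (((List.finRange n).filter fun j => j ∈ J).map fun j : Fin n =>
    .app (.var (j : ℕ)) (.num (g j)))

/-- The gradient `∇t(r)`: the tuple of the numerals of the partial derivatives at `r` of the
function denoted by `t`. -/
noncomputable def STm.nabla {S : Signature} {n : ℕ} (t : STm S (realCtx (n + 1)) .R)
    (r : Fin (n + 1) → ℝ) : Tm S :=
  .tuple n fun i => .num (deriv (fun s => t.realFun (Function.update r i s)) (r i))

/-! ### Recurrent neural networks -/

/-- The type of Church lists with entries in `A`. -/
def STy.list (A X : STy) : STy := .arr (.arr A (.arr X X)) (.arr X X)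

/-- The Church list `[a₁; …; aₙ] = λf. λx. f a₁ (f a₂ ⋯ (f aₙ x)⋯)` of numerals. -/
def churchList (S : Signature) (Γ : List STy) (X : STy) (l : List ℝ) : STm S Γ (STy.list .R X) :=
  .lam (.lam (l.foldr (fun a t => .app (.app (.var (.succ .zero)) (.num a)) t) (.var .zero)))

/-- The layer `L = λx. λh. σ(ε · x + ρ · h)`. -/
def layer (S : Signature) {Γ : List STy} (ε ρ : Var Γ .R) : STm S Γ (.arr .R (.arr .R .R)) :=
  .lam (.lam (.fn S.sig ![.add
    (.fn S.mul ![.var (.succ (.succ ε)), .var (.succ .zero)])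
    (.fn S.mul ![.var (.succ (.succ ρ)), .var .zero])]))

/-- The network `N = λl. l L 0`, with free variables `ε` (index `0`) and `ρ` (index `1`). -/
def network (S : Signature) : STm S (realCtx 2) (.arr (STy.list .R .R) .R) :=
  .lam (.app (.app (.var .zero) (layer S (.succ .zero) (.succ (.succ .zero)))) (.num 0))

/-- `N [a₁; …; aₙ]`. -/
def networkApp (S : Signature) (n : ℕ) (a : ℕ → ℝ) : STm S (realCtx 2) .R :=
  .app (network S) (churchList S _ .R ((List.range n).map fun i => a (i + 1)))

noncomputable section

/-- `u₀ = 0` and `uᵢ₊₁ = σ(e aₙ₋ᵢ + r uᵢ)`. -/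
def state (n : ℕ) (a : ℕ → ℝ) (e r : ℝ) : ℕ → ℝ
  | 0 => 0
  | i + 1 => Real.sigmoid (e * a (n - i) + r * state n a e r i)

/-- `dsig i` is `σ'ᵢ₊₁ = σ'(e aₙ₋ᵢ + r uᵢ)`. -/
def dsig (n : ℕ) (a : ℕ → ℝ) (e r : ℝ) (i : ℕ) : ℝ :=
  deriv Real.sigmoid (e * a (n - i) + r * state n a e r i)

/-- The recurrence for the derivative with respect to `ε`. -/
def gradEps (n : ℕ) (a : ℕ → ℝ) (e r : ℝ) : ℕ → ℝ
  | 0 => 0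
  | i + 1 => dsig n a e r i * (a (n - i) + r * gradEps n a e r i)

/-- The recurrence for the derivative with respect to `ρ`. -/
def gradRho (n : ℕ) (a : ℕ → ℝ) (e r : ℝ) : ℕ → ℝ
  | 0 => 0
  | i + 1 => dsig n a e r i * (state n a e r i + r * gradRho n a e r i)

end

/-! ### Substitution lemmas -/

/-! A Church list is a fold from the right, so everything is proved by induction on the length `i`
of the suffix already processed. In the set model that suffix, folded with the layer from `0`,
denotes `u_i` (`realFun_networkApp`). The chain rule for the sigmoid turns the recurrence for `u_i`
into those for the two partial derivatives, and joint differentiability follows by the same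
induction.

On the operational side the invariant (`rev_churchBody`) is that the transformed suffix reduces to a
pair of the numeral `u_i` and a value `w`, where `w` applied to a numeral `x` reduces to `ε* (g_ε x)
+ ρ* (g_ρ x)`, or to the null vector if `i = 0`. Values representing linear maps are described only
by their action on numerals, so no reduction under a `λ` is ever needed. One layer (`rev_layer`)
yields four summands: the one from the input numeral is null, and the part coming from `w` is merged
with the new `ε*` and `ρ*` terms by linear factoring. Applying the last dual to `1` gives the
gradient.

Every step is fired with empty substitution contexts on values, and neither `η` nor addition of
pairs is used. Hence reduction is handled through simultaneous substitutions: `beta`, `esub` and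
`letp` in the namespace `Reduces` perform whole substitutions at once. -/

theorem liftR_id : liftR (fun i => i) = fun i => i := by
  funext i; cases i <;> rfl

theorem liftR_comp (ξ ζ : ℕ → ℕ) : (fun i => liftR ξ (liftR ζ i)) = liftR fun i => ξ (ζ i) := by
  funext i; cases i <;> rfl

namespace Tm

variable {S : Signature}

/-- The substitution sending the variable `0` to `v` and the variable `i + 1` to `s i`. -/
def scons (v : Tm S) (s : ℕ → Tm S) : ℕ → Tm S
  | 0 => v
  | i + 1 => s i

theorem inst_eq_sub (v t : Tm S) : inst v t = sub (scons v var) t := by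
  unfold inst
  congr 1

theorem liftS_var : liftS (var : ℕ → Tm S) = var := by
  funext i; cases i <;> rfl

theorem liftS_liftR (s : ℕ → Tm S) (ξ : ℕ → ℕ) :
    (fun i => liftS s (liftR ξ i)) = liftS fun i => s (ξ i) := by
  funext i; cases i <;> rfl

theorem ren_id (t : Tm S) : ren (fun i => i) t = t := by
  induction t <;> simp_all [ren, liftR_id]

theorem ren_ren (ξ ζ : ℕ → ℕ) (t : Tm S) : ren ξ (ren ζ t) = ren (fun i => ξ (ζ i)) t := by
  induction t generalizing ξ ζ <;> simp_all [ren, liftR_comp]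

theorem sub_ren (s : ℕ → Tm S) (ξ : ℕ → ℕ) (t : Tm S) :
    sub s (ren ξ t) = sub (fun i => s (ξ i)) t := by
  induction t generalizing s ξ <;> simp_all [ren, sub, liftS_liftR]

theorem sub_var (t : Tm S) : sub var t = t := by
  induction t <;> simp_all [sub, liftS_var]

theorem ren_liftS (ξ : ℕ → ℕ) (s : ℕ → Tm S) :
    (fun i => ren (liftR ξ) (liftS s i)) = liftS fun i => ren ξ (s i) := by
  funext i
  cases i with
  | zero => rfl
  | succ i => simp only [liftS, shift, ren_ren]; rfl

theorem ren_sub (ξ : ℕ → ℕ) (s : ℕ → Tm S) (t : Tm S) :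
    ren ξ (sub s t) = sub (fun i => ren ξ (s i)) t := by
  induction t generalizing s ξ <;> simp_all [ren, sub, ren_liftS]

theorem sub_liftS (s s' : ℕ → Tm S) :
    (fun i => sub (liftS s) (liftS s' i)) = liftS fun i => sub s (s' i) := by
  funext i
  cases i with
  | zero => rfl
  | succ i => simp only [liftS, shift, sub_ren, ren_sub]

theorem sub_sub (s s' : ℕ → Tm S) (t : Tm S) :
    sub s (sub s' t) = sub (fun i => sub s (s' i)) t := by
  induction t generalizing s s' <;> simp_all [sub, sub_liftS]

theorem shift_zero (t : Tm S) : shift 0 t = t := ren_id t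

theorem shift_shift (m k : ℕ) (t : Tm S) : shift m (shift k t) = shift (k + m) t := by
  simp only [shift, ren_ren, Nat.add_assoc]

theorem sub_scons_shift (v : Tm S) (s : ℕ → Tm S) (t : Tm S) :
    sub (scons v s) (shift 1 t) = sub s t := sub_ren _ _ _

theorem sub_scons_shift_two (v w : Tm S) (s : ℕ → Tm S) (t : Tm S) :
    sub (scons v (scons w s)) (shift 2 t) = sub s t := sub_ren _ _ _

theorem sub_scons_sub_liftS (v : Tm S) (s : ℕ → Tm S) (t : Tm S) :
    sub (scons v var) (sub (liftS s) t) = sub (scons v s) t := by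
  rw [sub_sub]
  congr 1
  funext i
  cases i with
  | zero => rfl
  | succ i => exact (sub_scons_shift _ _ _).trans (sub_var _)

theorem sub_scons_sub_liftS_two (v w : Tm S) (s : ℕ → Tm S) (t : Tm S) :
    sub (scons v (scons w var)) (sub (liftS (liftS s)) t) = sub (scons v (scons w s)) t := by
  rw [sub_sub]
  congr 1
  funext i
  rcases i with _ | _ | i
  · rfl
  · rfl
  · simp only [liftS, shift_shift]
    exact (sub_scons_shift_two _ _ _ _).trans (sub_var _)

/-- Two nested explicit substitutions fuse into one simultaneous substitution; the shift of `v`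
accounts for its being under the outer binder. -/
theorem sub_scons_scons_shift (v w : Tm S) (s : ℕ → Tm S) (t : Tm S) :
    sub (scons w s) (sub (scons (shift 1 v) var) t) = sub (scons (sub s v) (scons w s)) t := by
  rw [sub_sub]
  congr 1
  funext i
  cases i with
  | zero => exact sub_scons_shift _ _ _
  | succ i => rfl

theorem sub_tuple (s : ℕ → Tm S) (n : ℕ) (ts : Fin (n + 1) → Tm S) :
    sub s (tuple n ts) = tuple n fun i => sub s (ts i) := by
  induction n with
  | zero => rfl
  | succ n ih => simp only [tuple, sub, ih]

theorem sub_zeroVec (s : ℕ → Tm S) (d : ℕ) : sub s (zeroVec d) = zeroVec d := sub_tuple _ _ _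

/-! ### Replacing all occurrences of a variable -/

/-- Arguments of a function symbol are rewritten one at a time; the induction runs over the set of
positions already treated. -/
theorem reflTransGen_pi {T : Type*} {k : ℕ} {P : T → T → Prop}
    {Q : (Fin k → T) → (Fin k → T) → Prop}
    (hQ : ∀ (ts : Fin k → T) (j : Fin k) (t' : T), P (ts j) t' → Q ts (Function.update ts j t'))
    (ts ts' : Fin k → T) (h : ∀ j, Relation.ReflTransGen P (ts j) (ts' j)) :
    Relation.ReflTransGen Q ts ts' := by
  classical
  have single : ∀ (us : Fin k → T) (j : Fin k) (t : T), Relation.ReflTransGen P (us j) t →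
      Relation.ReflTransGen Q us (Function.update us j t) := by
    intro us j t ht
    induction ht with
    | refl => simp only [Function.update_eq_self]; exact .refl
    | tail _ h ih =>
      refine ih.tail ?_
      simpa using hQ (Function.update us j _) j _ (by simpa using h)
  have key : ∀ s : Finset (Fin k), Relation.ReflTransGen Q ts (s.piecewise ts' ts) := by
    intro s
    induction s using Finset.induction_on with
    | empty => simp only [Finset.piecewise_empty]; exact .refl
    | insert j s hj ih =>
      rw [Finset.piecewise_insert]
      exact ih.trans (single _ _ _ (by simpa [hj] using h j))
  simpa using key Finset.univ

/-- The substitution of `v` for the variable `i`, leaving the other variables alone. -/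
def single (i : ℕ) (v : Tm S) : ℕ → Tm S := fun j => if j = i then v else var j

theorem liftS_single (i : ℕ) (v : Tm S) : liftS (single i v) = single (i + 1) (shift 1 v) := by
  funext j
  cases j with
  | zero => simp [liftS, single]
  | succ j =>
    by_cases h : j = i
    · simp [liftS, single, h]
    · simp [liftS, single, h, shift, ren]

/-- The structural induction visits each original occurrence once, so `v` may itself contain the
variable `i`. -/
theorem repl_single (i : ℕ) (v t : Tm S) :
    Relation.ReflTransGen (Repl i v) t (sub (single i v) t) := by
  induction t generalizing i v with
  | var j =>
    by_cases h : j = i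
    · subst h
      simpa [sub, single] using Relation.ReflTransGen.single Repl.here
    · simpa [sub, single, h] using Relation.ReflTransGen.refl
  | num r => exact .refl
  | lam a t ih =>
    simp only [sub, liftS_single]
    exact (ih (i + 1) (shift 1 v)).lift (lam a) fun _ _ h => h.lam
  | app t u iht ihu =>
    exact ((iht i v).lift (app · u) fun _ _ h => h.app_left).trans
      ((ihu i v).lift (app _ ·) fun _ _ h => h.app_right)
  | pair t u iht ihu =>
    exact ((iht i v).lift (pair · u) fun _ _ h => h.pair_left).trans
      ((ihu i v).lift (pair _ ·) fun _ _ h => h.pair_right)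
  | letp A B t u iht ihu =>
    simp only [sub, liftS_single, shift_shift]
    exact ((iht (i + 2) (shift 2 v)).lift (letp A B · u) fun _ _ h => h.letp_body).trans
      ((ihu i v).lift (letp A B _ ·) fun _ _ h => h.letp_arg)
  | esub a t u iht ihu =>
    simp only [sub, liftS_single]
    exact ((iht (i + 1) (shift 1 v)).lift (esub a · u) fun _ _ h => h.esub_body).trans
      ((ihu i v).lift (esub a _ ·) fun _ _ h => h.esub_arg)
  | add t u iht ihu =>
    exact ((iht i v).lift (add · u) fun _ _ h => h.add_left).trans
      ((ihu i v).lift (add _ ·) fun _ _ h => h.add_right)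
  | fn f ts ih =>
    exact (reflTransGen_pi (Q := fun us us' => Repl i v (fn f us) (fn f us'))
      (fun _ _ _ h => h.fn) _ _ fun j => ih j i v).lift (fn f) fun _ _ h => h

end Tm

/-! ### Reduction of programs with values -/

namespace Reduces

open Tm

variable {S : Signature} {Γ : List Ann}

theorem refl (t : Tm S) : Reduces Γ t t := Relation.ReflTransGen.refl

theorem trans {t u v : Tm S} (h : Reduces Γ t u) (h' : Reduces Γ u v) : Reduces Γ t v :=
  Relation.ReflTransGen.trans h h'

theorem of_root {t u : Tm S} (h : Root Γ t u) : Reduces Γ t u :=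
  Relation.ReflTransGen.single (.inl (.root h))

theorem of_sumEq {t u : Tm S} (h : SumEq Γ t u) : Reduces Γ t u :=
  Relation.ReflTransGen.single (.inr (.root h))

theorem map {Δ : List Ann} (f : Tm S → Tm S)
    (hf : ∀ (P : List Ann → Tm S → Tm S → Prop) (t u : Tm S),
      CtxClosure P Δ t u → CtxClosure P Γ (f t) (f u))
    {t u : Tm S} (h : Reduces Δ t u) : Reduces Γ (f t) (f u) :=
  Relation.ReflTransGen.lift f (fun _ _ h => h.imp (hf _ _ _) (hf _ _ _)) _ _ h

theorem app_left {t t' : Tm S} (u : Tm S) (h : Reduces Γ t t') :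
    Reduces Γ (.app t u) (.app t' u) :=
  h.map (Tm.app · u) fun _ _ _ => .app_left

theorem app_right (t : Tm S) {u u' : Tm S} (h : Reduces Γ u u') :
    Reduces Γ (.app t u) (.app t u') :=
  h.map (Tm.app t ·) fun _ _ _ => .app_right

theorem letp_arg (A B : Ty) (t : Tm S) {u u' : Tm S} (h : Reduces Γ u u') :
    Reduces Γ (.letp A B t u) (.letp A B t u') :=
  h.map (Tm.letp A B t ·) fun _ _ _ => .letp_arg

theorem pair_left {t t' : Tm S} (u : Tm S) (h : Reduces Γ t t') :
    Reduces Γ (.pair t u) (.pair t' u) :=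
  h.map (Tm.pair · u) fun _ _ _ => .pair_left

theorem esub_body {a : Ann} {t t' : Tm S} (u : Tm S) (h : Reduces (a :: Γ) t t') :
    Reduces Γ (.esub a t u) (.esub a t' u) :=
  h.map (Tm.esub a · u) fun _ _ _ => .esub_body

theorem add {t t' u u' : Tm S} (h : Reduces Γ t t') (h' : Reduces Γ u u') :
    Reduces Γ (.add t u) (.add t' u') :=
  (h.map (Tm.add · u) fun _ _ _ => .add_left).trans
    (h'.map (Tm.add t' ·) fun _ _ _ => .add_right)

theorem fn {k : ℕ} (f : S.F' k) {ts ts' : Fin k → Tm S} (h : ∀ i, Reduces Γ (ts i) (ts' i)) :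
    Reduces Γ (.fn f ts) (.fn f ts') :=
  (reflTransGen_pi
    (Q := fun us us' => CtxClosure Root Γ (Tm.fn f us) (.fn f us') ∨
      CtxClosure SumEq Γ (Tm.fn f us) (.fn f us'))
    (fun _ _ _ h => h.imp .fn .fn) ts ts' h).lift (Tm.fn f) fun _ _ h => h

/-- The calculus replaces one occurrence at a time and keeps the explicit substitution; exhausting
the occurrences and then collecting the garbage amounts to a meta-level substitution. -/
theorem esub_exp (A : Ty) (t : Tm S) {v : Tm S} (hv : v.IsValue) :
    Reduces Γ (.esub (.exp A) t v) (sub (scons v var) t) := by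
  have step : ∀ t t' : Tm S, Repl 0 (shift 1 v) t t' →
      Reduces Γ (.esub (.exp A) t v) (.esub (.exp A) t' v) := fun t t' h => by
    refine of_root (Root.subst A t t' v [] hv ?_)
    simpa [SCtx.size, liftR_id, ren_id] using h
  have chain : ∀ t', Relation.ReflTransGen (Repl 0 (shift 1 v)) t t' →
      Reduces Γ (.esub (.exp A) t v) (.esub (.exp A) t' v) := fun t' h => by
    induction h with
    | refl => exact refl _
    | tail _ h ih => exact ih.trans (step _ _ h)
  -- No occurrence of the bound variable remains, which for garbage collection must appear as being
  -- a shifted term.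
  have e : sub (single 0 (shift 1 v)) t = shift 1 (sub (scons v var) t) := by
    rw [shift.eq_def 1 (sub _ t), ren_sub]
    congr 1
    funext i
    cases i <;> simp [single, scons, shift, ren]
  refine (chain _ (repl_single _ _ _)).trans ?_
  rw [e]
  simpa [SCtx.size, SCtx.plug, shift_zero] using
    of_root (Root.gc (Γ := Γ) A (sub (scons v var) t) v [] hv)

theorem esub_lin (t : Tm S) {v : Tm S} (hv : v.IsValue) :
    Reduces Γ (.esub .lin t v) (sub (scons v var) t) := by
  simpa [SCtx.size, SCtx.plug, liftR_id, ren_id, inst_eq_sub] using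
    of_root (Root.lin (Γ := Γ) t v [] hv)

theorem esub (a : Ann) (t : Tm S) {v : Tm S} (hv : v.IsValue) :
    Reduces Γ (.esub a t v) (sub (scons v var) t) := by
  cases a with
  | exp A => exact esub_exp A t hv
  | lin => exact esub_lin t hv

theorem beta (a : Ann) (t : Tm S) {v : Tm S} (hv : v.IsValue) :
    Reduces Γ (.app (.lam a t) v) (sub (scons v var) t) := by
  refine trans ?_ (esub a t hv)
  simpa [SCtx.size, SCtx.plug, shift_zero] using of_root (Root.beta (Γ := Γ) a t v [])

theorem beta_sub (a : Ann) (s : ℕ → Tm S) (t : Tm S) {v : Tm S} (hv : v.IsValue) :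
    Reduces Γ (.app (sub s (.lam a t)) v) (sub (scons v s) t) := by
  simpa [sub, sub_scons_sub_liftS] using beta (Γ := Γ) a (sub (liftS s) t) hv

theorem _root_.Tm.IsValue.ren {v : Tm S} (hv : v.IsValue) (ξ : ℕ → ℕ) : (v.ren ξ).IsValue := by
  induction hv <;> simp only [Tm.ren] <;> constructor <;> assumption

theorem letp (A B : Ty) (s : Tm S) {v w : Tm S} (hv : v.IsValue) (hw : w.IsValue) :
    Reduces Γ (.letp A B s (.pair v w)) (sub (scons v (scons w var)) s) := by
  have h1 := of_root (Root.unpair (Γ := Γ) A B s v w [])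
  simp only [SCtx.size, SCtx.plug, liftRN, Nat.add_zero, liftR_id, ren_id] at h1
  refine h1.trans ((esub_body w (esub_exp A s (hv.ren _))).trans ?_)
  refine (esub_exp B _ hw).trans ?_
  have e := sub_scons_scons_shift v w var s
  rw [sub_var] at e
  rw [← e]
  exact refl _

theorem esub_esub (a b : Ann) (t : Tm S) {u v : Tm S} (hu : u.IsValue) (hv : v.IsValue) :
    Reduces Γ (.esub a (.esub b t (shift 1 u)) v) (sub (scons u (scons v var)) t) := by
  refine (esub_body v (esub b t (hu.ren _))).trans ((esub a _ hv).trans ?_)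
  have e := sub_scons_scons_shift u v var t
  rw [sub_var] at e
  rw [← e]
  exact refl _

/-- The reduction of `b[⟨x, x*⟩/t][⟨y, y*⟩/u]`. -/
theorem letp_letp (A B A' B' : Ty) (b : Tm S) {t u x x' y y' : Tm S} (hx : x.IsValue)
    (hx' : x'.IsValue) (hy : y.IsValue) (hy' : y'.IsValue) (ht : Reduces Γ t (.pair x x'))
    (hu : Reduces Γ u (.pair y y')) :
    Reduces Γ (.letp A' B' (.letp A B b (shift 2 t)) u)
      (sub (scons x (scons x' (scons y (scons y' var)))) b) := by
  refine (letp_arg _ _ _ hu).trans ((letp _ _ _ hy hy').trans ?_)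
  -- The inner argument is shifted past both outer variables, so the outer substitution leaves it
  -- unchanged.
  simp only [sub, sub_scons_shift_two, sub_var]
  refine (letp_arg _ _ _ ht).trans ((letp _ _ _ hx hx').trans ?_)
  rw [sub_scons_sub_liftS_two]
  exact refl _

theorem compAll_nil (k : ℕ) : SCtx.compAll k (fun _ => ([] : SCtx S)) = [] := by
  induction k with
  | zero => rfl
  | succ k ih => simp only [SCtx.compAll, ih]; rfl

theorem fn_num {k : ℕ} (f : S.F' k) (r : Fin k → ℝ) :
    Reduces Γ (.fn f fun i => .num (r i)) (.num (S.sem f r)) := by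
  have h := of_root (Root.fn (Γ := Γ) f r fun _ => [])
  rwa [compAll_nil] at h

theorem mul_num {t u : Tm S} {x y : ℝ} (ht : Reduces Γ t (.num x)) (hu : Reduces Γ u (.num y)) :
    Reduces Γ (.mul t u) (.num (x * y)) := by
  refine (fn (ts' := fun i => .num (![x, y] i)) _ ?_).trans ?_
  · simpa [Fin.forall_fin_two] using ⟨ht, hu⟩
  · simpa [S.sem_mul] using fn_num (Γ := Γ) (S.incl S.mul) ![x, y]

theorem add_num (x y : ℝ) : Reduces Γ (.add (.num x) (.num y) : Tm S) (.num (x + y)) :=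
  of_root (Root.plus (Γ := Γ) x y [] [])

theorem add_zeroVec (t : Tm S) (d : ℕ) : Reduces Γ (.add t (.zeroVec d)) t :=
  of_sumEq (.zero t d)

/-- `SumEq` orients associativity one way only; commutativity recovers the other direction. -/
theorem add_assoc' (s t u : Tm S) : Reduces Γ (.add s (.add t u)) (.add (.add s t) u) :=
  (of_sumEq (.comm _ _)).trans <| (of_sumEq (.assoc _ _ _)).trans <|
    (of_sumEq (.comm _ _)).trans <| (of_sumEq (.assoc _ _ _)).trans (of_sumEq (.comm _ _))

/-- Brings together the two `ε*` terms and the two `ρ*` terms, as factoring requires. -/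
theorem add_interchange (s t u v : Tm S) :
    Reduces Γ (.add s (.add t (.add u v))) (.add (.add s u) (.add t v)) :=
  (add (refl s) ((of_sumEq (.comm _ _)).trans ((of_sumEq (.assoc _ _ _)).trans
    (add (refl u) (of_sumEq (.comm _ _)))))).trans (add_assoc' _ _ _)

theorem factor {x d : ℕ} (hx : Γ[x]? = some (.exp (.neg d))) (p q : ℝ) :
    Reduces Γ (.add (.app (.var x) (.num p)) (.app (.var x) (.num q)) : Tm S)
      (.app (.var x) (.num (p + q))) :=
  (of_root (Root.factor (Γ := Γ) x d (.num p) (.num q) [] [] [] [] hx)).trans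
    (app_right _ (add_num p q))

end Reduces

/-! ### The transforms of sums and function symbols -/

namespace Tm

variable {S : Signature}

theorem sub_mul (s : ℕ → Tm S) (t u : Tm S) : sub s (mul t u) = mul (sub s t) (sub s u) := by
  simp only [mul, sub]
  congr 1
  funext i
  fin_cases i <;> rfl

theorem sub_liftS_two_shift (s : ℕ → Tm S) (t : Tm S) :
    sub (liftS (liftS s)) (shift 2 t) = shift 2 (sub s t) := by
  simp only [shift, sub_ren, ren_sub]
  congr 1
  funext i
  simp only [liftS, shift_shift]
  rfl

theorem sub_scons_num_shift (q : ℝ) (w : Tm S) :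
    sub (scons (num q) var) (shift 1 w) = w := by
  rw [sub_scons_shift, sub_var]

end Tm

/-! ### Partial derivatives of multiplication and of the sigmoid -/

namespace Signature

variable (S : Signature)

theorem sem_par_mul_zero (v : Fin 2 → ℝ) : S.sem (S.par S.mul 0) v = v 1 := by
  rw [S.sem_par]
  simp [S.sem_mul]

theorem sem_par_mul_one (v : Fin 2 → ℝ) : S.sem (S.par S.mul 1) v = v 0 := by
  rw [S.sem_par]
  simp [S.sem_mul]

theorem sem_par_sig (v : Fin 1 → ℝ) : S.sem (S.par S.sig 0) v = deriv Real.sigmoid (v 0) := by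
  rw [S.sem_par]
  simp [S.sem_sig]

end Signature

namespace Reduces

open Tm

variable {S : Signature} {Γ : List Ann}

theorem fn_one (f : S.F' 1) {ts : Fin 1 → Tm S} {x : ℝ} (h : ts 0 = .num x) :
    Reduces Γ (.fn f ts) (.num (S.sem f ![x])) := by
  have e : ts = fun i => .num (![x] i) := by
    funext i; fin_cases i; simpa using h
  rw [e]; exact fn_num f _

theorem fn_two (f : S.F' 2) {ts : Fin 2 → Tm S} {x y : ℝ} (h : ts 0 = .num x)
    (h' : ts 1 = .num y) : Reduces Γ (.fn f ts) (.num (S.sem f ![x, y])) := by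
  have e : ts = fun i => .num (![x, y] i) := by
    funext i; fin_cases i
    · simpa using h
    · simpa using h'
  rw [e]; exact fn_num f _

theorem rev_add {d : ℕ} {Δ : List STy} (s : ℕ → Tm S) {t u : STm S Δ .R} {x y : ℝ} {w w' : Tm S}
    (hw : w.IsValue) (hw' : w'.IsValue)
    (ht : Reduces Γ (sub s (t.rev d)) (.pair (.num x) w))
    (hu : Reduces Γ (sub s (u.rev d)) (.pair (.num y) w')) :
    ∃ w'' : Tm S, w''.IsValue ∧
      Reduces Γ (sub s ((STm.add t u).rev d)) (.pair (.num (x + y)) w'') ∧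
      ∀ q, Reduces Γ (.app w'' (.num q)) (.add (.app w (.num q)) (.app w' (.num q))) := by
  refine ⟨.lam .lin (.add (.app (shift 1 w) (.var 0)) (.app (shift 1 w') (.var 0))), .lam _ _,
    ?_, fun q => ?_⟩
  · simp only [STm.rev]
    rw [sub, sub, sub_liftS_two_shift]
    refine (letp_letp _ _ _ _ _ (.num x) hw (.num y) hw' ht hu).trans ?_
    exact pair_left _ (add_num x y)
  · refine (beta .lin _ (.num q)).trans ?_
    simp only [sub, sub_scons_num_shift]
    exact refl _

/-- The dual keeps its partial derivatives unevaluated at the numerals `x` and `y`; they are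
computed only once it is applied, each factor receiving the cotangent multiplied by the other
factor. -/
theorem rev_mul {d : ℕ} {Δ : List STy} (s : ℕ → Tm S) {t u : STm S Δ .R} {x y : ℝ} {w w' : Tm S}
    (hw : w.IsValue) (hw' : w'.IsValue)
    (ht : Reduces Γ (sub s (t.rev d)) (.pair (.num x) w))
    (hu : Reduces Γ (sub s (u.rev d)) (.pair (.num y) w')) :
    ∃ w'' : Tm S, w''.IsValue ∧
      Reduces Γ (sub s ((STm.fn S.mul ![t, u]).rev d)) (.pair (.num (x * y)) w'') ∧
      ∀ q, Reduces Γ (.app w'' (.num q))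
        (.add (.app w (.num (y * q))) (.app w' (.num (x * q)))) := by
  have hmul : S.sem (S.incl S.mul) ![x, y] = x * y := by simp [S.sem_mul]
  refine ⟨.lam .lin (.add
    (.app (shift 1 w) (.mul (.fn (S.par S.mul 0) fun i => .num (![x, y] i)) (.var 0)))
    (.app (shift 1 w') (.mul (.fn (S.par S.mul 1) fun i => .num (![x, y] i)) (.var 0)))),
    .lam _ _, ?_, fun q => ?_⟩
  · simp only [STm.rev, letPairs]
    rw [sub, sub, sub_liftS_two_shift]
    refine (letp_letp _ _ _ _ _ (.num x) hw (.num y) hw' ht hu).trans ?_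
    simp only [List.finRange_succ, List.finRange_zero, List.map_cons, List.map_nil, Tm.sum, sub,
      sub_mul]
    rw [← hmul]
    refine (pair_left _ (fn_two (x := x) (y := y) _ rfl rfl)).trans ?_
    -- The substituted argument family agrees with the family of numerals index by index, but not
    -- syntactically as a function.
    have e : ∀ s : Fin 2 → Tm S, s 0 = .num x → s 1 = .num y → s = fun i => .num (![x, y] i) := by
      intro s h h'
      funext i; fin_cases i
      · simpa using h
      · simpa using h'
    rw [e (fun j => sub (liftS (scons (.num x) (scons w (scons (.num y) (scons w' .var)))))
      (liftS (liftS (liftS (liftS (liftS s)))) (2 * (j : ℕ) + 1))) rfl rfl]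
    exact refl _
  · refine (beta .lin _ (.num q)).trans ?_
    simp only [sub, sub_mul, sub_scons_num_shift]
    refine add (app_right _ (mul_num ?_ (refl _))) (app_right _ (mul_num ?_ (refl _)))
    · simpa [S.sem_par_mul_zero] using fn_num (Γ := Γ) (S.par S.mul 0) ![x, y]
    · simpa [S.sem_par_mul_one] using fn_num (Γ := Γ) (S.par S.mul 1) ![x, y]

theorem rev_sig {d : ℕ} {Δ : List STy} (s : ℕ → Tm S) {t : STm S Δ .R} {x : ℝ} {w : Tm S}
    (hw : w.IsValue) (ht : Reduces Γ (sub s (t.rev d)) (.pair (.num x) w)) :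
    ∃ w' : Tm S, w'.IsValue ∧
      Reduces Γ (sub s ((STm.fn S.sig ![t]).rev d)) (.pair (.num (Real.sigmoid x)) w') ∧
      ∀ q, Reduces Γ (.app w' (.num q)) (.app w (.num (deriv Real.sigmoid x * q))) := by
  have hsig : S.sem (S.incl S.sig) ![x] = Real.sigmoid x := by simp [S.sem_sig]
  refine ⟨.lam .lin
    (.app (shift 1 w) (.mul (.fn (S.par S.sig 0) fun i => .num (![x] i)) (.var 0))),
    .lam _ _, ?_, fun q => ?_⟩
  · simp only [STm.rev, letPairs]
    rw [sub]
    refine (letp_arg _ _ _ ht).trans ((letp _ _ _ (.num x) hw).trans ?_)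
    simp only [List.finRange_succ, List.finRange_zero, List.map_cons, List.map_nil, Tm.sum, sub,
      sub_mul]
    rw [← hsig]
    refine (pair_left _ (fn_one (x := x) _ rfl)).trans ?_
    have e : ∀ s : Fin 1 → Tm S, s 0 = .num x → s = fun i => .num (![x] i) := by
      intro s h
      funext i; fin_cases i
      simpa using h
    rw [e (fun j => sub (liftS (scons (.num x) (scons w .var)))
      (liftS (liftS (liftS s)) (2 * (j : ℕ) + 1))) rfl]
    exact refl _
  · refine (beta .lin _ (.num q)).trans ?_
    simp only [sub, sub_mul, sub_scons_num_shift]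
    refine app_right _ (mul_num ?_ (refl _))
    simpa [S.sem_par_sig] using fn_num (Γ := Γ) (S.par S.sig 0) ![x]

end Reduces

/-! ### The derivatives of the network -/

theorem hasDerivAt_sigmoid_comp {f : ℝ → ℝ} {f' x : ℝ} (hf : HasDerivAt f f' x) :
    HasDerivAt (fun s => Real.sigmoid (f s)) (deriv Real.sigmoid (f x) * f') x :=
  (differentiable_sigmoid.differentiableAt.hasDerivAt (x := f x)).comp x hf

theorem hasDerivAt_state_eps (n : ℕ) (a : ℕ → ℝ) (e r : ℝ) (i : ℕ) :
    HasDerivAt (fun s => state n a s r i) (gradEps n a e r i) e := by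
  induction i with
  | zero => exact hasDerivAt_const _ _
  | succ i ih =>
    refine hasDerivAt_sigmoid_comp ?_
    simpa using ((hasDerivAt_id e).mul_const (a (n - i))).fun_add (ih.const_mul r)

theorem hasDerivAt_state_rho (n : ℕ) (a : ℕ → ℝ) (e r : ℝ) (i : ℕ) :
    HasDerivAt (fun s => state n a e s i) (gradRho n a e r i) r := by
  induction i with
  | zero => exact hasDerivAt_const _ _
  | succ i ih =>
    refine hasDerivAt_sigmoid_comp ?_
    simpa using ((hasDerivAt_id r).fun_mul ih).const_add (e * a (n - i))

theorem differentiable_state (n : ℕ) (a : ℕ → ℝ) (i : ℕ) :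
    Differentiable ℝ fun v : Fin 2 → ℝ => state n a (v 0) (v 1) i := by
  induction i with
  | zero => exact differentiable_const _
  | succ i ih =>
    refine differentiable_sigmoid.comp (f := fun v : Fin 2 → ℝ =>
      v 0 * a (n - i) + v 1 * state n a (v 0) (v 1) i) ?_
    fun_prop

/-- The last `i` entries of the list `[a₁; …; aₙ]`. -/
def suffix (n : ℕ) (a : ℕ → ℝ) (i : ℕ) : List ℝ :=
  (List.range i).map fun j => a (n - i + j + 1)

/-- The bound on `i` keeps the subtraction from truncating, so the new head is exactly the input `a
(n - i)` of the recurrence. -/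
theorem suffix_succ (n : ℕ) (a : ℕ → ℝ) {i : ℕ} (h : i < n) :
    suffix n a (i + 1) = a (n - i) :: suffix n a i := by
  simp only [suffix, List.range_succ_eq_map, List.map_cons, List.map_map]
  congr 1
  · congr 1; omega
  · refine List.map_congr_left fun j _ => ?_
    simp only [Function.comp]
    congr 1; omega

theorem suffix_self (n : ℕ) (a : ℕ → ℝ) :
    suffix n a n = (List.range n).map fun i => a (i + 1) := by
  simp [suffix]

/-- The body of the Church list. -/
def churchBody (S : Signature) (Γ : List STy) (X : STy) (l : List ℝ) :
    STm S (X :: .arr .R (.arr X X) :: Γ) X :=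
  l.foldr (fun a t => .app (.app (.var (.succ .zero)) (.num a)) t) (.var .zero)

theorem realFun_networkApp (S : Signature) (n : ℕ) (a : ℕ → ℝ) (v : Fin 2 → ℝ) :
    (networkApp S n a).realFun v = state n a (v 0) (v 1) n := by
  have key : ∀ i ≤ n, ∀ (g : Env (realCtx 2)),
      (churchBody S (realCtx 2) .R (suffix n a i)).sem
        ((0 : ℝ), (fun x h : ℝ => Real.sigmoid (v 0 * x + v 1 * h)), g) =
      state n a (v 0) (v 1) i := by
    intro i hi g
    induction i with
    | zero => rfl
    | succ i ih =>
      rw [suffix_succ n a (by omega)]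
      -- The denotation of the fold with one more entry is, by computation, one more layer applied
      -- to the previous state.
      exact congrArg (fun u : ℝ => Real.sigmoid (v 0 * a (n - i) + v 1 * u)) (ih (by omega))
  have hL : ∀ g, (layer S (Γ := STy.list .R .R :: realCtx 2) (.succ .zero)
      (.succ (.succ .zero))).sem (g, realEnv 2 v) =
      fun x h : ℝ => Real.sigmoid (v 0 * x + v 1 * h) := by
    intro g
    funext x h
    exact (S.sem_sig _).trans
      (congrArg Real.sigmoid (congrArg₂ (fun x y : ℝ => x + y) (S.sem_mul _) (S.sem_mul _)))
  rw [← key n le_rfl (realEnv 2 v), ← hL, suffix_self]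
  rfl

/-! ### The reverse gradient transformation of the network -/

/-- The linear combination `ε* p + ρ* q` of the two free variables. -/
def linComb (S : Signature) (p q : ℝ) : Tm S :=
  .add (.app (.var 0) (.num p)) (.app (.var 1) (.num q))

/-- The typing context `ε* : R^⊥, ρ* : R^⊥`. -/
abbrev dualCtx (d : ℕ) : List Ann := [.exp (.neg d), .exp (.neg d)]

/-- The function `λa. 0` attached to a numeral. -/
def zeroDual (S : Signature) (d : ℕ) : Tm S := .lam .lin (.zeroVec d)

/-- The value `w` represents the linear map `a ↦ ε* (p a) + ρ* (q a)`, which is null if `i = 0`. -/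
def IsDual {S : Signature} (d : ℕ) (w : Tm S) (p q : ℝ) (i : ℕ) : Prop :=
  ∀ x : ℝ, Reduces (dualCtx d) (.app w (.num x))
    (if i = 0 then .zeroVec d else linComb S (p * x) (q * x))

/-- The body of the layer. -/
def layerBody (S : Signature) {Γ : List STy} (ε ρ : Var Γ .R) : STm S (.R :: .R :: Γ) .R :=
  .fn S.sig ![.add
    (.fn S.mul ![.var (.succ (.succ ε)), .var (.succ .zero)])
    (.fn S.mul ![.var (.succ (.succ ρ)), .var .zero])]

namespace Reduces

open Tm

variable {S : Signature}

theorem app_zeroDual {Γ : List Ann} (d : ℕ) (q : ℝ) :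
    Reduces Γ (.app (zeroDual S d) (.num q)) (.zeroVec d) := by
  have h := beta (Γ := Γ) .lin (zeroVec d : Tm S) (.num q)
  rwa [sub_zeroVec] at h

/-- Here the cotangent is multiplied by the sigmoid derivative, copied by the sum, and sent by each
product to its two factors. The four summands stay separate because their simplification depends on
the duals supplied. -/
theorem rev_layerBody {d : ℕ} {Δ : List STy} (ε ρ : Var Δ .R) (s : ℕ → Tm S)
    {e r x u : ℝ} {wε wρ wx w : Tm S}
    (hε : s (ε.idx + 2) = .pair (.num e) wε) (hρ : s (ρ.idx + 2) = .pair (.num r) wρ)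
    (hx : s 1 = .pair (.num x) wx) (hu : s 0 = .pair (.num u) w)
    (vε : wε.IsValue) (vρ : wρ.IsValue) (vx : wx.IsValue) (vw : w.IsValue) {Γ : List Ann} :
    ∃ w' : Tm S, w'.IsValue ∧
      Reduces Γ (sub s ((layerBody S ε ρ).rev d))
        (.pair (.num (Real.sigmoid (e * x + r * u))) w') ∧
      ∀ q, Reduces Γ (.app w' (.num q))
        (.add
          (.add (.app wε (.num (x * (deriv Real.sigmoid (e * x + r * u) * q))))
            (.app wx (.num (e * (deriv Real.sigmoid (e * x + r * u) * q)))))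
          (.add (.app wρ (.num (u * (deriv Real.sigmoid (e * x + r * u) * q))))
            (.app w (.num (r * (deriv Real.sigmoid (e * x + r * u) * q)))))) := by
  obtain ⟨w₁, v₁, h₁, d₁⟩ := rev_mul (Γ := Γ) (d := d) s (t := .var (.succ (.succ ε)))
    (u := .var (.succ .zero)) vε vx
    (by rw [← hε]; simp only [STm.rev, sub, Var.idx]; exact refl _)
    (by rw [← hx]; simp only [STm.rev, sub, Var.idx]; exact refl _)
  obtain ⟨w₂, v₂, h₂, d₂⟩ := rev_mul (Γ := Γ) (d := d) s (t := .var (.succ (.succ ρ)))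
    (u := .var .zero) vρ vw
    (by rw [← hρ]; simp only [STm.rev, sub, Var.idx]; exact refl _)
    (by rw [← hu]; simp only [STm.rev, sub, Var.idx]; exact refl _)
  obtain ⟨w₃, v₃, h₃, d₃⟩ := rev_add s v₁ v₂ h₁ h₂
  obtain ⟨w₄, v₄, h₄, d₄⟩ := rev_sig s v₃ h₃
  exact ⟨w₄, v₄, h₄, fun q => (d₄ q).trans ((d₃ _).trans (add (d₁ _) (d₂ _)))⟩

/-- One step of backpropagation. -/
theorem rev_layer {d : ℕ} {Δ : List STy} (ε ρ : Var Δ .R) (s : ℕ → Tm S)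
    {e r x u p q : ℝ} {i : ℕ} {wε wρ w : Tm S}
    (hε : s ε.idx = .pair (.num e) wε) (hρ : s ρ.idx = .pair (.num r) wρ)
    (vε : wε.IsValue) (vρ : wρ.IsValue) (vw : w.IsValue)
    (dε : ∀ x, Reduces (dualCtx d) (.app wε (.num x)) (.app (.var 0) (.num x)))
    (dρ : ∀ x, Reduces (dualCtx d) (.app wρ (.num x)) (.app (.var 1) (.num x)))
    (dw : IsDual d w p q i) (hp : i = 0 → p = 0) (hq : i = 0 → q = 0) :
    ∃ w' : Tm S, w'.IsValue ∧
      Reduces (dualCtx d) (.app (.app (sub s ((layer S ε ρ).rev d))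
          (.pair (.num x) (zeroDual S d))) (.pair (.num u) w))
        (.pair (.num (Real.sigmoid (e * x + r * u))) w') ∧
      IsDual d w' (deriv Real.sigmoid (e * x + r * u) * (x + r * p))
        (deriv Real.sigmoid (e * x + r * u) * (u + r * q)) (i + 1) := by
  obtain ⟨w', v', h', d'⟩ := rev_layerBody (d := d) (Γ := dualCtx d) ε ρ
    (scons (.pair (.num u) w) (scons (.pair (.num x) (zeroDual S d)) s)) hε hρ rfl rfl vε vρ
    (.lam _ _) vw
  refine ⟨w', v', ?_, fun y => (d' y).trans ?_⟩
  · refine (app_left _ (beta_sub _ _ _ (.pair (.num x) (.lam _ _)))).trans ?_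
    exact (beta_sub _ _ _ (.pair (.num u) vw)).trans h'
  · generalize deriv Real.sigmoid (e * x + r * u) = c
    -- The input is a numeral, whose dual is null, so only the `ε*` term survives from the first
    -- product.
    have h₁ : Reduces (dualCtx d)
        (.add (.app wε (.num (x * (c * y)))) (.app (zeroDual S d) (.num (e * (c * y)))))
        (.app (.var 0) (.num (x * (c * y)))) :=
      (add (dε _) (app_zeroDual d _)).trans (add_zeroVec _ d)
    simp only [Nat.add_eq_zero_iff, one_ne_zero, and_false, if_false]
    have dw' := dw (r * (c * y))
    -- The initial dual returns a bare null vector, not `ε* 0 + ρ* 0`: there is nothing to factor,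
    -- and `p = q = 0` makes the coefficients agree.
    by_cases hi : i = 0
    · rw [if_pos hi] at dw'
      rw [hp hi, hq hi]
      have e₁ : c * (x + r * 0) * y = x * (c * y) := by ring
      have e₂ : c * (u + r * 0) * y = u * (c * y) := by ring
      rw [e₁, e₂]
      exact add h₁ ((add (dρ _) dw').trans (add_zeroVec _ d))
    · rw [if_neg hi] at dw'
      have e₁ : c * (x + r * p) * y = x * (c * y) + p * (r * (c * y)) := by ring
      have e₂ : c * (u + r * q) * y = u * (c * y) + q * (r * (c * y)) := by ring
      rw [e₁, e₂]
      -- Each tag now occurs twice, once from this layer and once from the earlier ones; factoring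
      -- adds their coefficients.
      exact (add h₁ (add (dρ _) dw')).trans
        ((add_interchange _ _ _ _).trans (add (factor (d := d) rfl _ _) (factor (d := d) rfl _ _)))

/-- Two substitutions occur: `s` instantiates the bound variables of the Church list, and `s'` the
free variables of the layer that `s` supplies as the folded function. -/
theorem rev_churchBody {d : ℕ} {Δ Δ' : List STy} (ε ρ : Var Δ .R) (n : ℕ) (a : ℕ → ℝ)
    (s s' : ℕ → Tm S) {e r : ℝ} {wε wρ : Tm S}
    (hε : s' ε.idx = .pair (.num e) wε) (hρ : s' ρ.idx = .pair (.num r) wρ)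
    (vε : wε.IsValue) (vρ : wρ.IsValue)
    (dε : ∀ x, Reduces (dualCtx d) (.app wε (.num x)) (.app (.var 0) (.num x)))
    (dρ : ∀ x, Reduces (dualCtx d) (.app wρ (.num x)) (.app (.var 1) (.num x)))
    (h₀ : s 0 = .pair (.num 0) (zeroDual S d)) (h₁ : s 1 = sub s' ((layer S ε ρ).rev d))
    (i : ℕ) (hi : i ≤ n) :
    ∃ w : Tm S, w.IsValue ∧
      Reduces (dualCtx d) (sub s ((churchBody S Δ' .R (suffix n a i)).rev d))
        (.pair (.num (state n a e r i)) w) ∧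
      IsDual d w (gradEps n a e r i) (gradRho n a e r i) i := by
  induction i with
  | zero =>
    refine ⟨zeroDual S d, .lam _ _, ?_, fun x => ?_⟩
    · rw [state, ← h₀]
      exact refl _
    · simpa using app_zeroDual d x
  | succ i ih =>
    obtain ⟨w, vw, hw, dw⟩ := ih (by omega)
    obtain ⟨w', vw', hw', dw'⟩ := rev_layer (x := a (n - i)) (u := state n a e r i) ε ρ s' hε hρ
      vε vρ vw dε dρ dw (by rintro rfl; rfl) (by rintro rfl; rfl)
    refine ⟨w', vw', ?_, dw'⟩
    rw [suffix_succ n a (by omega)]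
    show Reduces (dualCtx d) (.app (.app (s 1) (.pair (.num _) (.lam .lin (sub _ (.zeroVec d)))))
      (sub s ((churchBody S Δ' .R (suffix n a i)).rev d))) _
    rw [sub_zeroVec, h₁]
    exact (app_right _ hw).trans hw'

theorem gradProgram_networkApp (n : ℕ) (a : ℕ → ℝ) (e r : ℝ) (d : ℕ) :
    Reduces (dualCtx d) ((networkApp S n a).gradProgram d ![e, r])
      (if n = 0 then .zeroVec d else linComb S (gradEps n a e r n) (gradRho n a e r n)) := by
  -- Once the two numerals are substituted, `ε*` and `ρ*` have indices `0` and `1`, hence `1` and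
  -- `2` under the linear binder.
  set wε : Tm S := .lam .lin (.app (.var 1) (.var 0))
  set wρ : Tm S := .lam .lin (.app (.var 2) (.var 0))
  set σ : ℕ → Tm S := scons (.num e) (scons (.num r) var)
  set s : ℕ → Tm S := scons (.pair (.num e) wε) (scons (.pair (.num r) wρ) σ)
  have vE : (Tm.pair (.num e) wε).IsValue := .pair (.num e) (.lam _ _)
  have vR : (Tm.pair (.num r) wρ).IsValue := .pair (.num r) (.lam _ _)
  have h₁ : Reduces (dualCtx d) ((networkApp S n a).gradProgram d ![e, r])
      (.letp .R (.neg d) (.app (.var 1) (.num 1)) (sub s ((networkApp S n a).rev d))) := by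
    refine (esub_esub _ _ _ (.num e) (.num r)).trans ?_
    refine letp_arg _ _ _ ?_
    show Reduces _ (.esub _ (.esub _ (sub (liftS (liftS σ)) ((networkApp S n a).rev d))
      (shift 1 (.pair (.num e) wε))) (.pair (.num r) wρ)) _
    refine (esub_esub _ _ _ vE vR).trans ?_
    rw [sub_scons_sub_liftS_two]
    exact refl _
  set L := STm.rev d (layer S (Γ := STy.list .R .R :: realCtx 2) (.succ .zero)
    (.succ (.succ .zero)))
  set C := sub s (STm.rev d (churchList S (realCtx 2) .R (suffix n a n)))
  have h₂ : Reduces (dualCtx d) (sub s ((networkApp S n a).rev d))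
      (sub (scons (.pair (.num 0) (zeroDual S d)) (scons (sub (scons C s) L) s))
        ((churchBody S (realCtx 2) .R (suffix n a n)).rev d)) := by
    rw [networkApp, ← suffix_self]
    -- Three β-steps bind the list, then the layer, then the initial state; each argument is already
    -- a value.
    refine (beta_sub _ s _ (.lam _ _)).trans ?_
    show Reduces _ (.app (.app C (sub (scons C s) L)) (.pair (.num 0)
      (.lam .lin (sub _ (.zeroVec d))))) _
    rw [sub_zeroVec]
    refine (app_left _ (beta_sub _ s _ (.lam _ _))).trans ?_
    exact beta_sub _ _ _ (.pair (.num 0) (.lam _ _))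
  obtain ⟨w, vw, hw, dw⟩ := rev_churchBody (S := S) (d := d) (Δ := STy.list .R .R :: realCtx 2)
    (Δ' := realCtx 2) (.succ .zero) (.succ (.succ .zero)) n a
    (scons (.pair (.num 0) (zeroDual S d)) (scons (sub (scons C s) L) s)) (scons C s)
    (e := e) (r := r) (wε := wε) (wρ := wρ) rfl rfl (.lam _ _) (.lam _ _)
    (fun x => beta .lin _ (.num x)) (fun x => beta .lin _ (.num x)) rfl rfl n le_rfl
  refine h₁.trans ((letp_arg _ _ _ (h₂.trans hw)).trans ((letp _ _ _ (.num _) vw).trans ?_))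
  -- The numeral `1` is the seed of the reverse pass.
  have h := dw 1
  rw [mul_one, mul_one] at h
  exact h

end Reduces

/-! ### Tagged sums and the final statement -/

theorem taggedSum_empty (S : Signature) (d : ℕ) {n : ℕ} (g : Fin n → ℝ) :
    taggedSum (S := S) d ∅ g = .zeroVec d := by
  simp [taggedSum, Tm.sum]

theorem taggedSum_univ_two (S : Signature) (d : ℕ) (p q : ℝ) :
    taggedSum (S := S) d Finset.univ ![p, q] = linComb S p q := by
  simp [taggedSum, Tm.sum, List.finRange_succ, linComb]

theorem mainTheorem6 (S : Signature) (n : ℕ) (a : ℕ → ℝ) (e r : ℝ) :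
    Differentiable ℝ (fun v : Fin 2 → ℝ => (networkApp S n a).realFun v) ∧
    (networkApp S n a).nabla ![e, r] =
      Tm.pair (Tm.num (gradEps n a e r n)) (Tm.num (gradRho n a e r n)) ∧
    ∃ J : Finset (Fin 2),
      (∀ j, j ∉ J → (![gradEps n a e r n, gradRho n a e r n] : Fin 2 → ℝ) j = 0) ∧
      ∀ d : ℕ, Reduces [Ann.exp (Ty.neg d), Ann.exp (Ty.neg d)]
        ((networkApp S n a).gradProgram d ![e, r])
        (taggedSum d J ![gradEps n a e r n, gradRho n a e r n]) := by
  -- The empty list gives the null vector with no tag at all; otherwise both tags appear, even with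
  -- a zero coefficient. The choice depends only on `n`.
  refine ⟨?_, ?_, if n = 0 then ∅ else Finset.univ, ?_, fun d => ?_⟩
  · simp only [realFun_networkApp]
    exact differentiable_state n a n
  · simp only [STm.nabla, realFun_networkApp, Tm.tuple]
    congr 2
    · simpa using (hasDerivAt_state_eps n a e r n).deriv
    · simpa using (hasDerivAt_state_rho n a e r n).deriv
  · intro j hj
    by_cases hn : n = 0
    · subst hn
      fin_cases j <;> rfl
    · simp [hn] at hj
  · have h := Reduces.gradProgram_networkApp (S := S) n a e r d
    by_cases hn : n = 0
    · simpa [hn, taggedSum_empty] using h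
    · simpa [hn, taggedSum_univ_two] using h
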